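/- Let $n\ge 0$ and let $\Delta_n=\{(i,j): 1\le i\le j\le n\}$, drawn as a triangle: the bottom row consists of $(1,1),\dots,(n,n)$ from left to right, moving up and to the right replaces $j$ by $j+1$, and moving down and to the right replaces $i$ by $i+1$. The $i$-th column is $(i,i),(i,i+1),\dots,(i,n)$, listed from its lowest position upward, and the top position is $(1,n)$. Positions are called balls or boxes. A torsion class of size $n$ (a torsion class for $A_n$) is a set $T\subseteq\Delta_n$ of balls that is closed under quotients (if $(i,j)\in T$ and $i<j$, then $(i+1,j)\in T$) and under extensions (if $(a,b),(c,d)\in T$ with $a<c\le b+1$ and $b<d$, then $(a,d)\in T$). Equivalently, $T$ is the first member of a torsion pair of subsets of $\Delta_n$, where $\mathrm{Hom}((a,b),(c,d))\ne 0$ if and only if $a\le c\le b\le d$. The full Young diagram with gaps of size $n$ is $\Delta_n$. A subdiagram with gaps of it is a set $D\subseteq\Delta_n$ of boxes such that every column hangs from the ceiling (if $(i,j)\in D$ and $j<n$, then $(i,j+1)\in D$) and has been slid down as far as possible (if $(i,j)$ is the lowest box of $D$ in column $i$, then $(i',j)\in D$ for all $i\le i'\le j$). Removing the gaps from $D$ means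 sorting its columns by their numbers of boxes in descending order and pushing them together into an ordinary Young diagram. The full Young diagram without gaps of size $n$ is the staircase with rows of $n,n-1,\dots,1$ boxes. Let $T$ be a set of balls in $\Delta_n$. The set $\Phi_n(T)\subseteq\Delta_n$ is defined recursively on the parts $\{(i,j): a\le i\le j\le b\}$ of $\Delta_n$, starting with $a=1$, $b=n$; an empty part gives no boxes. Consider the $k\in\{a,\dots,b\}$ such that for every $i\in\{a,\dots,k\}$ some $(i,j)\in T$ has $i\le j\le k$. If there are such $k$, take the one for which the rectangle $\{(i,j): a\le i\le k\le j\le b\}$ has the largest number of boxes (the smallest such $k$ if there are several); put boxes on this rectangle, and treat the part $X$ on its left (from $a$ to $k-1$) and the part $Y$ on its right (from $k+1$ to $b$) in the same way. If there is no such $k$ (for a torsion class: if column $a$ has no ball of $T$ in this part), omit column $a$ and continue with the part from $a+1$ to $b$. Then the following hold. 1. For every torsion class $T$ of size $n$, $\Phi_n(T)$ is obtained by putting boxes, in each column that contains a ball of $T$, on the lowest ball of $T$ and on all positions above it in the column. 2. $\Phi_n$ is a bijection from the set of torsion classes of size $n$ onto the set of subdiagrams with gaps of the full Young diagram with gaps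 of size $n$. 3. Removing the gaps is a bijection from the set of subdiagrams with gaps of the full Young diagram with gaps of size $n$ onto the set of Young diagrams contained in the full Young diagram without gaps of size $n$. -/

import Mathlib

/-!
Balls and boxes.  The triangular configuration of size `n` has the positions `(i, j)` with
`1 ≤ i ≤ j ≤ n`.  The bottom row consists of the positions `(i, i)`, from left to right, and
`(i, j)` has height `j - i`.  Moving up and to the right replaces `j` by `j + 1`; moving down and
to the right replaces `i` by `i + 1`.  Hence the `i`-th column (ascending diagonal, columns being
numbered from the left) is `(i, i), (i, i + 1), …, (i, n)`, listed from its lowest position upward,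
a descending diagonal has constant `j`, and the top position is `(1, n)`.
-/

namespace TorsionYoung

/-- The triangular configuration of size `n`: it is the ball structure of size `n`, and also (as a
set of boxes) the full Young diagram with gaps of size `n`. -/
def triangle (n : ℕ) : Finset (ℕ × ℕ) :=
  (Finset.Icc 1 n ×ˢ Finset.Icc 1 n).filter fun p => p.1 ≤ p.2

/-! ### Torsion classes -/

/-- A torsion class of size `n`: a set of (coloured) balls that is closed under quotients (the lower
right neighbour of a coloured ball is coloured) and under extensions (if the coloured balls `(a, b)`
and `(c, d)` are the left and the right corner of a rectangle whose lowest corner `(c, b)` is in the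
configuration or at most one line below it, then its highest corner `(a, d)` is coloured). -/
structure IsTorsionClass (n : ℕ) (T : Finset (ℕ × ℕ)) : Prop where
  subset : T ⊆ triangle n
  quotient : ∀ i j, (i, j) ∈ T → i < j → (i + 1, j) ∈ T
  extension : ∀ a b c d, (a, b) ∈ T → (c, d) ∈ T → a < c → b < d → c ≤ b + 1 → (a, d) ∈ T

/-- `Hom(X, Y) ≠ 0`: the entire rectangle with left corner `X` and right corner `Y` lies in the
configuration. -/
def HomNonzero (X Y : ℕ × ℕ) : Prop :=
  X.1 ≤ Y.1 ∧ X.2 ≤ Y.2 ∧ Y.1 ≤ X.2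

/-- Torsion pairs of sets of balls: each of the two sets is the Hom-orthogonal of the other. -/
def IsTorsionPair (n : ℕ) (G F : Finset (ℕ × ℕ)) : Prop :=
  (∀ X, X ∈ G ↔ X ∈ triangle n ∧ ∀ Y ∈ F, ¬ HomNonzero X Y) ∧
  (∀ Y, Y ∈ F ↔ Y ∈ triangle n ∧ ∀ X ∈ G, ¬ HomNonzero X Y)

theorem mem_triangle {n i j : ℕ} : (i, j) ∈ triangle n ↔ 1 ≤ i ∧ i ≤ j ∧ j ≤ n := by
  simp only [triangle, Finset.mem_filter, Finset.mem_product, Finset.mem_Icc]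
  omega

theorem IsTorsionClass.quotient_of_le {n : ℕ} {T : Finset (ℕ × ℕ)} (h : IsTorsionClass n T)
    {i j k : ℕ} (hij : (i, j) ∈ T) (hik : i ≤ k) (hkj : k ≤ j) : (k, j) ∈ T := by
  induction k, hik using Nat.le_induction with
  | base => exact hij
  | succ k hk ih => exact h.quotient k j (ih (by omega)) (by omega)

/-- The two usual descriptions of torsion classes agree: the sets of balls closed under quotients
and extensions are the first components of the torsion pairs. -/
theorem isTorsionClass_iff_exists_isTorsionPair (n : ℕ) (T : Finset (ℕ × ℕ)) :
    IsTorsionClass n T ↔ ∃ F, IsTorsionPair n T F := by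
  classical
  constructor
  · intro h
    refine ⟨(triangle n).filter fun Y => ∀ X ∈ T, ¬ HomNonzero X Y, ?_, fun Y => by simp⟩
    rintro ⟨a, b⟩
    constructor
    · intro hX
      exact ⟨h.subset hX, fun Y hY => (Finset.mem_filter.1 hY).2 _ hX⟩
    · rintro ⟨hX, hF⟩
      by_contra hT
      obtain ⟨h1, h2, h3⟩ := mem_triangle.1 hX
      by_cases hne : ∃ d, d ≤ b ∧ (a, d) ∈ T
      · obtain ⟨d₀, hd₀, hd₀T⟩ := hne
        have hs := Nat.findGreatest_spec (P := fun d => (a, d) ∈ T) hd₀ hd₀T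
        have hle := Nat.findGreatest_le (P := fun d => (a, d) ∈ T) b
        have hmax := fun k => Nat.findGreatest_is_greatest (P := fun d => (a, d) ∈ T) (n := b) (k := k)
        generalize Nat.findGreatest (fun d => (a, d) ∈ T) b = d at hs hle hmax
        have hdb : d ≠ b := by
          rintro rfl
          exact hT hs
        have had := mem_triangle.1 (h.subset hs)
        refine hF (d + 1, b) (Finset.mem_filter.2 ⟨mem_triangle.2 ⟨by omega, by omega, h3⟩, ?_⟩)
          ⟨by simp; omega, le_rfl, by simp; omega⟩
        rintro ⟨e, f⟩ hef ⟨k1, k2, k3⟩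
        simp only at k1 k2 k3
        exact hmax f (by omega) k2 (h.extension a d (d + 1) f hs
          (h.quotient_of_le hef k1 k3) (by omega) (by omega) le_rfl)
      · push Not at hne
        refine hF (a, b) (Finset.mem_filter.2 ⟨hX, ?_⟩) ⟨le_rfl, le_rfl, h2⟩
        rintro ⟨e, f⟩ hef ⟨k1, k2, k3⟩
        exact hne f k2 (h.quotient_of_le hef k1 k3)
  · rintro ⟨F, hG, -⟩
    refine ⟨fun X hX => ((hG X).1 hX).1, ?_, ?_⟩
    · intro i j hij hlt
      obtain ⟨h1, h2⟩ := (hG _).1 hij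
      rw [mem_triangle] at h1
      refine (hG _).2 ⟨mem_triangle.2 (by omega), ?_⟩
      rintro ⟨c, d⟩ hY ⟨k1, k2, k3⟩
      simp only at k1 k2 k3
      exact h2 _ hY ⟨by simp; omega, k2, k3⟩
    · intro a b c d hab hcd hac hbd hcb
      obtain ⟨h1, h2⟩ := (hG _).1 hab
      obtain ⟨h3, h4⟩ := (hG _).1 hcd
      rw [mem_triangle] at h1 h3
      refine (hG _).2 ⟨mem_triangle.2 (by omega), ?_⟩
      rintro ⟨e, f⟩ hY ⟨k1, k2, k3⟩
      simp only at k1 k2 k3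
      by_cases heb : e ≤ b
      · exact h2 _ hY ⟨k1, by simp; omega, heb⟩
      · exact h4 _ hY ⟨by simp; omega, k2, k3⟩

/-! ### Young diagrams, with and without gaps -/

/-- `D` is a subdiagram, and a Young diagram with gaps, of the full Young diagram with gaps of size
`n`: every column of `D` hangs from the ceiling without interruption, and has been slid down as far
as possible, that is, the lowest box `(i, j)` of a column cannot slide further down, because the
positions `(i', j)` on its descending diagonal are occupied all the way to the bottom line. -/
structure IsGappedSubdiagram (n : ℕ) (D : Finset (ℕ × ℕ)) : Prop where
  subset : D ⊆ triangle n
  ceiling : ∀ i j, (i, j) ∈ D → j < n → (i, j + 1) ∈ D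
  floor : ∀ i j, (i, j) ∈ D → (∀ j' < j, (i, j') ∉ D) → ∀ i', i ≤ i' → i' ≤ j → (i', j) ∈ D

/-- The number of boxes of `D` in column `i`. -/
def columnSize (D : Finset (ℕ × ℕ)) (i : ℕ) : ℕ :=
  (D.filter fun p => p.1 = i).card

/-- Removing the gaps: the columns of `D` are sorted by their numbers of boxes, in descending order,
and pushed together into an ordinary Young diagram (whose columns are the rows of its transpose). -/
def removeGaps (n : ℕ) (D : Finset (ℕ × ℕ)) : YoungDiagram :=
  (YoungDiagram.ofRowLens (((Finset.Icc 1 n).val.map (columnSize D)).sort (· ≥ ·))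
    (Multiset.pairwise_sort _ _).sortedGE).transpose

/-- The full Young diagram without gaps of size `n`: its rows have `n, n - 1, …, 1` boxes. -/
def staircase (n : ℕ) : YoungDiagram where
  cells := (Finset.range n ×ˢ Finset.range n).filter fun p => p.1 + p.2 < n
  isLowerSet := by
    rintro ⟨a, b⟩ ⟨c, d⟩ ⟨h1, h2⟩ h
    simp only [Finset.coe_filter, Finset.mem_product, Finset.mem_range, Set.mem_ofPred_eq] at *
    omega

/-! ### From torsion classes to Young diagrams with gaps -/

/-- The boxes put on each column from its lowest coloured ball upward. -/
def columnFill (n : ℕ) (T : Finset (ℕ × ℕ)) : Finset (ℕ × ℕ) :=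
  (triangle n).filter fun p => ∃ j ∈ Finset.Icc p.1 p.2, (p.1, j) ∈ T

/-- The rectangle with lowest corner `(k, k)` and highest corner `(a, b)`. -/
def rectangle (a k b : ℕ) : Finset (ℕ × ℕ) :=
  Finset.Icc a k ×ˢ Finset.Icc k b

/-- Consider the part of the configuration below `(a, b)`, that is, the positions `(i, j)` with
`a ≤ i ≤ j ≤ b`.  These are the `k` for which all boxes of `rectangle a k b` belong to the diagram:
each of the columns `a, …, k` has a coloured ball at or below its position `(i, k)`. -/
def pivots (T : Finset (ℕ × ℕ)) (a b : ℕ) : Finset ℕ :=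
  (Finset.Icc a b).filter fun k => ∀ i ∈ Finset.Icc a k, ∃ j ∈ Finset.Icc i k, (i, j) ∈ T

/-- The pivots whose rectangle has the largest number of boxes. -/
def bestPivots (T : Finset (ℕ × ℕ)) (a b : ℕ) : Finset ℕ :=
  (pivots T a b).filter fun k =>
    ∀ l ∈ pivots T a b, (rectangle a l b).card ≤ (rectangle a k b).card

theorem mem_Icc_of_mem_bestPivots {T : Finset (ℕ × ℕ)} {a b k : ℕ} (h : k ∈ bestPivots T a b) :
    a ≤ k ∧ k ≤ b :=
  Finset.mem_Icc.1 (Finset.mem_filter.1 (Finset.mem_filter.1 h).1).1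

/-- The recursively defined map, on the part of size `s` whose leftmost column is column `a`.
If there is a rectangle in the diagram that reaches from the bottom line to the top position, take
the largest one (the leftmost one, if there are several) and treat the part `X` on its left, of size
`k - a`, and the part `Y` on its right, of size `a + s - k`, in the same way.  Otherwise (for a
torsion class: if the leftmost column has no coloured ball) omit the leftmost column. -/
def recursiveDiagram (T : Finset (ℕ × ℕ)) (a : ℕ) : ℕ → Finset (ℕ × ℕ)
  | 0 => ∅
  | s + 1 =>
    if h : (bestPivots T a (a + s)).Nonempty then
      rectangle a ((bestPivots T a (a + s)).min' h) (a + s) ∪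
        (recursiveDiagram T a ((bestPivots T a (a + s)).min' h - a) ∪
          recursiveDiagram T ((bestPivots T a (a + s)).min' h + 1)
            (a + s - (bestPivots T a (a + s)).min' h))
    else recursiveDiagram T (a + 1) s
termination_by s => s
decreasing_by
  all_goals first
    | (have := mem_Icc_of_mem_bestPivots (Finset.min'_mem _ h); omega)
    | omega

end TorsionYoung

namespace TorsionYoung

/-! ### Torsion classes and their column fillings -/

/-! A torsion class is determined by the lowest balls of its columns: `(a, b)` is a ball exactly
when each of the columns `a, …, b` has a ball at or below diagonal `b`. Quotients give one
direction. For the other, join a ball `(a, l)` to `(l + 1, b)` by an extension and induct. So the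
pivots of a part are the `k` with `(a, k)` in `T`, and each pivot splits the column filling of the
part into its rectangle and the fillings of `X` and `Y`; any choice of pivot yields the same
diagram. The inverse map colours the positions whose descending diagonal is filled down to the
bottom (`filledDiagonals`).

For the third claim, let `S j` be the set of columns with a box on diagonal `j`. Row `h` without
gaps has `(S (n - h)).card` boxes. The ceiling condition says that the `S j` increase; the floor
condition says that `S (j + 1)` arises from `S j` by adding the largest missing elements of `{1, …,
j + 1}`. Hence the cardinalities determine the chain, and every monotone sequence of cardinalities
bounded by `j` occurs. These sequences are the row lengths of the diagrams inside the staircase. -/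

theorem mem_columnFill {n i j : ℕ} {T : Finset (ℕ × ℕ)} :
    (i, j) ∈ columnFill n T ↔
      (1 ≤ i ∧ i ≤ j ∧ j ≤ n) ∧ ∃ j', (i ≤ j' ∧ j' ≤ j) ∧ (i, j') ∈ T := by
  simp [columnFill, mem_triangle]

/-- A torsion class is recovered from the columns of its balls: a ball is coloured as soon as every
position to its lower right on its descending diagonal has a coloured ball at or below it. -/
theorem IsTorsionClass.mem_of_forall {n : ℕ} {T : Finset (ℕ × ℕ)} (hT : IsTorsionClass n T)
    {a b : ℕ} (hab : a ≤ b)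
    (h : ∀ i, a ≤ i → i ≤ b → ∃ j, (i ≤ j ∧ j ≤ b) ∧ (i, j) ∈ T) : (a, b) ∈ T := by
  induction hs : b - a using Nat.strong_induction_on generalizing a with
  | _ s ih =>
    obtain ⟨l, ⟨hal, hlb⟩, hl⟩ := h a le_rfl hab
    rcases hlb.eq_or_lt with rfl | hlt
    · exact hl
    · refine hT.extension a l (l + 1) b hl ?_ (by omega) hlt le_rfl
      exact ih (b - (l + 1)) (by omega) hlt (fun i hi hib => h i (by omega) hib) rfl

theorem IsTorsionClass.mem_iff {n : ℕ} {T : Finset (ℕ × ℕ)} (hT : IsTorsionClass n T) {a b : ℕ} :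
    (a, b) ∈ T ↔ (1 ≤ a ∧ a ≤ b ∧ b ≤ n) ∧ ∀ i, a ≤ i → i ≤ b → (i, b) ∈ columnFill n T := by
  constructor
  · intro h
    have hab := mem_triangle.1 (hT.subset h)
    exact ⟨hab, fun i hi hib => mem_columnFill.2
      ⟨⟨by omega, hib, hab.2.2⟩, b, ⟨hib, le_rfl⟩, hT.quotient_of_le h hi hib⟩⟩
  · rintro ⟨hab, h⟩
    exact hT.mem_of_forall hab.2.1 fun i hi hib => (mem_columnFill.1 (h i hi hib)).2

/-! ### Pivots and the recursive diagram -/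

theorem mem_pivots {T : Finset (ℕ × ℕ)} {a b k : ℕ} :
    k ∈ pivots T a b ↔
      (a ≤ k ∧ k ≤ b) ∧ ∀ i, a ≤ i → i ≤ k → ∃ j, (i ≤ j ∧ j ≤ k) ∧ (i, j) ∈ T := by
  simp [pivots]

theorem IsTorsionClass.mem_pivots_iff {n : ℕ} {T : Finset (ℕ × ℕ)} (hT : IsTorsionClass n T)
    {a b k : ℕ} : k ∈ pivots T a b ↔ k ≤ b ∧ (a, k) ∈ T := by
  rw [mem_pivots]
  constructor
  · rintro ⟨⟨hak, hkb⟩, h⟩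
    exact ⟨hkb, hT.mem_of_forall hak h⟩
  · rintro ⟨hkb, h⟩
    exact ⟨⟨(mem_triangle.1 (hT.subset h)).2.1, hkb⟩, fun i hi hik =>
      ⟨k, ⟨hik, le_rfl⟩, hT.quotient_of_le h hi hik⟩⟩

theorem bestPivots_nonempty {T : Finset (ℕ × ℕ)} {a b : ℕ} (h : (pivots T a b).Nonempty) :
    (bestPivots T a b).Nonempty := by
  obtain ⟨k, hk, hmax⟩ := (pivots T a b).exists_max_image (fun k => (rectangle a k b).card) h
  exact ⟨k, Finset.mem_filter.2 ⟨hk, hmax⟩⟩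

/-- Induction on the size of the part. The only property of the chosen pivot that matters is `(a, k)
∈ T`: quotients then put a ball on `(i, k)` for all `a ≤ i ≤ k`, so the rectangle is filled, and
what remains of the part is `X` and `Y`. -/
theorem IsTorsionClass.mem_recursiveDiagram {n : ℕ} {T : Finset (ℕ × ℕ)}
    (hT : IsTorsionClass n T) (s a i j : ℕ) :
    (i, j) ∈ recursiveDiagram T a s ↔
      (a ≤ i ∧ i ≤ j ∧ j < a + s) ∧ ∃ j', (i ≤ j' ∧ j' ≤ j) ∧ (i, j') ∈ T := by
  induction s using Nat.strong_induction_on generalizing a with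
  | _ s ih =>
    rcases s with _ | s
    · rw [recursiveDiagram]
      simp only [Finset.notMem_empty, false_iff]
      rintro ⟨h, -⟩
      omega
    · rw [recursiveDiagram]
      split_ifs with h
      · have hmem := Finset.min'_mem _ h
        have hle := mem_Icc_of_mem_bestPivots hmem
        have hk := (hT.mem_pivots_iff.1 (Finset.mem_filter.1 hmem).1).2
        generalize (bestPivots T a (a + s)).min' h = k at hle hk
        rw [Finset.mem_union, Finset.mem_union, ih _ (by omega), ih _ (by omega)]
        simp only [rectangle, Finset.mem_product, Finset.mem_Icc]
        constructor
        · rintro (h | ⟨h, h'⟩ | ⟨h, h'⟩)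
          · exact ⟨by omega, k, by omega, hT.quotient_of_le hk (by omega) (by omega)⟩
          · exact ⟨by omega, h'⟩
          · exact ⟨by omega, h'⟩
        · rintro ⟨h, h'⟩
          by_cases hik : k < i
          · exact Or.inr (Or.inr ⟨by omega, h'⟩)
          · by_cases hjk : j < k
            · exact Or.inr (Or.inl ⟨by omega, h'⟩)
            · exact Or.inl (by omega)
      · rw [ih s (by omega)]
        constructor
        · rintro ⟨h, h'⟩
          exact ⟨by omega, h'⟩
        · rintro ⟨h1, j', hj', hT'⟩
          refine ⟨⟨?_, by omega, by omega⟩, j', hj', hT'⟩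
          by_contra hlt
          obtain rfl : i = a := by omega
          -- A ball of column `a` inside the part would itself give a pivot, so the omitted column
          -- is empty.
          exact h (bestPivots_nonempty ⟨j', hT.mem_pivots_iff.2 ⟨by omega, hT'⟩⟩)

theorem IsTorsionClass.recursiveDiagram_eq {n : ℕ} {T : Finset (ℕ × ℕ)}
    (hT : IsTorsionClass n T) : recursiveDiagram T 1 n = columnFill n T := by
  ext ⟨i, j⟩
  rw [hT.mem_recursiveDiagram, mem_columnFill]
  refine and_congr_left fun _ => ?_
  omega

/-! ### Column fillings and filled diagonals -/

theorem IsTorsionClass.isGappedSubdiagram {n : ℕ} {T : Finset (ℕ × ℕ)}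
    (hT : IsTorsionClass n T) : IsGappedSubdiagram n (columnFill n T) where
  subset := Finset.filter_subset _ _
  ceiling i j h hj := by
    obtain ⟨h1, j', h2, h3⟩ := mem_columnFill.1 h
    exact mem_columnFill.2 ⟨by omega, j', by omega, h3⟩
  floor i j h hlow i' hi hj := by
    obtain ⟨h1, j', h2, h3⟩ := mem_columnFill.1 h
    -- The lowest box of a column is a ball, so quotients fill its diagonal.
    obtain rfl : j' = j := by
      by_contra hne
      exact hlow j' (by omega) (mem_columnFill.2 ⟨by omega, j', by omega, h3⟩)
    exact mem_columnFill.2 ⟨by omega, j', by omega, hT.quotient_of_le h3 hi hj⟩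

theorem IsGappedSubdiagram.mem_of_le {n : ℕ} {D : Finset (ℕ × ℕ)} (hD : IsGappedSubdiagram n D)
    {i j k : ℕ} (h : (i, j) ∈ D) (hjk : j ≤ k) (hk : k ≤ n) : (i, k) ∈ D := by
  induction k, hjk using Nat.le_induction with
  | base => exact h
  | succ k _ ih => exact hD.ceiling i k (ih (by omega)) (by omega)

/-- The balls whose descending diagonal is filled with boxes of `D` down to the bottom line. -/
def filledDiagonals (n : ℕ) (D : Finset (ℕ × ℕ)) : Finset (ℕ × ℕ) :=
  (triangle n).filter fun p => ∀ i ∈ Finset.Icc p.1 p.2, (i, p.2) ∈ D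

theorem mem_filledDiagonals {n a b : ℕ} {D : Finset (ℕ × ℕ)} :
    (a, b) ∈ filledDiagonals n D ↔
      (1 ≤ a ∧ a ≤ b ∧ b ≤ n) ∧ ∀ i, a ≤ i → i ≤ b → (i, b) ∈ D := by
  simp [filledDiagonals, mem_triangle]

theorem IsGappedSubdiagram.isTorsionClass {n : ℕ} {D : Finset (ℕ × ℕ)}
    (hD : IsGappedSubdiagram n D) : IsTorsionClass n (filledDiagonals n D) where
  subset := Finset.filter_subset _ _
  quotient i j h hij := by
    obtain ⟨h1, h2⟩ := mem_filledDiagonals.1 h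
    exact mem_filledDiagonals.2 ⟨by omega, fun k hk => h2 k (by omega)⟩
  extension a b c d hab hcd hac hbd hcb := by
    obtain ⟨h1, h2⟩ := mem_filledDiagonals.1 hab
    obtain ⟨h3, h4⟩ := mem_filledDiagonals.1 hcd
    refine mem_filledDiagonals.2 ⟨by omega, fun i hi hid => ?_⟩
    by_cases hic : c ≤ i
    · exact h4 i hic hid
    · exact hD.mem_of_le (h2 i hi (by omega)) hbd.le h3.2.2

/-- The floor condition makes the lowest box of each column a ball of `filledDiagonals n D`, and the
ceiling condition supplies everything above it. -/
theorem IsGappedSubdiagram.columnFill_filledDiagonals {n : ℕ} {D : Finset (ℕ × ℕ)}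
    (hD : IsGappedSubdiagram n D) : columnFill n (filledDiagonals n D) = D := by
  classical
  ext ⟨i, j⟩
  rw [mem_columnFill]
  constructor
  · rintro ⟨h1, j', h2, h3⟩
    exact hD.mem_of_le ((mem_filledDiagonals.1 h3).2 i le_rfl h2.1) h2.2 h1.2.2
  · intro h
    have h1 := mem_triangle.1 (hD.subset h)
    have hex : ∃ j', (i, j') ∈ D := ⟨j, h⟩
    have hmem := Nat.find_spec hex
    have hle := Nat.find_le (h := hex) h
    have h2 := mem_triangle.1 (hD.subset hmem)
    exact ⟨h1, Nat.find hex, ⟨h2.2.1, hle⟩, mem_filledDiagonals.2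
      ⟨h2, hD.floor i _ hmem fun j' hj' => Nat.find_min hex hj'⟩⟩

theorem bijOn_recursiveDiagram (n : ℕ) :
    Set.BijOn (fun T : Finset (ℕ × ℕ) => recursiveDiagram T 1 n)
      {T | IsTorsionClass n T} {D | IsGappedSubdiagram n D} := by
  refine ⟨fun T hT => ?_, fun T hT T' hT' h => ?_, fun D hD => ?_⟩
  · have hT : IsTorsionClass n T := hT
    simpa [hT.recursiveDiagram_eq] using hT.isGappedSubdiagram
  · have hT : IsTorsionClass n T := hT
    have hT' : IsTorsionClass n T' := hT'
    have h : recursiveDiagram T 1 n = recursiveDiagram T' 1 n := h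
    rw [hT.recursiveDiagram_eq, hT'.recursiveDiagram_eq] at h
    ext ⟨a, b⟩
    rw [hT.mem_iff, hT'.mem_iff, h]
  · have hD : IsGappedSubdiagram n D := hD
    exact ⟨filledDiagonals n D, hD.isTorsionClass,
      hD.isTorsionClass.recursiveDiagram_eq.trans hD.columnFill_filledDiagonals⟩

/-! ### Removing the gaps -/

/-- In a descending list the entries exceeding `h` form an initial segment. This is the conjugation
of partitions that turns column sizes into row lengths. -/
theorem exists_lt_getElem_iff_lt_countP {w : List ℕ} (hw : w.Pairwise (· ≥ ·)) (t h : ℕ) :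
    (∃ ht : t < w.length, h < w[t]) ↔ t < w.countP (h < ·) := by
  induction w generalizing t with
  | nil => simp
  | cons x w ih =>
    rw [List.pairwise_cons] at hw
    by_cases hx : h < x
    · rw [List.countP_cons_of_pos (by simpa using hx)]
      rcases t with _ | t
      · simp [hx]
      · simpa using ih hw.2 t
    · have hz : ∀ y ∈ x :: w, ¬ h < y := by
        intro y hy
        rcases List.mem_cons.1 hy with rfl | hy
        · exact hx
        · have := hw.1 y hy
          omega
      have hc : (x :: w).countP (h < ·) = 0 := List.countP_eq_zero.2 (by simpa using hz)
      rw [hc]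
      simp only [not_lt_zero, iff_false]
      rintro ⟨ht, hlt⟩
      exact hz _ (List.getElem_mem ht) hlt

/-- The columns of `D` that have a box in the descending diagonal `j`. -/
def diagonal (n : ℕ) (D : Finset (ℕ × ℕ)) (j : ℕ) : Finset ℕ :=
  (Finset.Icc 1 n).filter fun i => (i, j) ∈ D

theorem IsGappedSubdiagram.mem_diagonal {n i j : ℕ} {D : Finset (ℕ × ℕ)}
    (hD : IsGappedSubdiagram n D) : i ∈ diagonal n D j ↔ (i, j) ∈ D := by
  refine ⟨fun h => (Finset.mem_filter.1 h).2, fun h => Finset.mem_filter.2 ⟨?_, h⟩⟩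
  have := mem_triangle.1 (hD.subset h)
  exact Finset.mem_Icc.2 (by omega)

/-- A column hangs from diagonal `n`, so its boxes occupy the topmost diagonals. For `h ≥ n` the
subtraction gives diagonal `0`, which has no boxes, and both sides fail. -/
theorem IsGappedSubdiagram.lt_columnSize_iff {n : ℕ} {D : Finset (ℕ × ℕ)}
    (hD : IsGappedSubdiagram n D) (i h : ℕ) : h < columnSize D i ↔ (i, n - h) ∈ D := by
  constructor
  · intro hlt
    by_contra hmem
    have hsub : D.filter (fun p => p.1 = i) ⊆ {i} ×ˢ Finset.Icc (n - h + 1) n := by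
      rintro ⟨i', j⟩ hp
      obtain ⟨hmem', rfl⟩ := Finset.mem_filter.1 hp
      have hj := mem_triangle.1 (hD.subset hmem')
      simp only [Finset.mem_product, Finset.mem_singleton, Finset.mem_Icc, true_and]
      refine ⟨?_, hj.2.2⟩
      by_contra hlow
      exact hmem (hD.mem_of_le hmem' (by omega) (by omega))
    have hcard := Finset.card_le_card hsub
    simp only [Finset.card_product, Finset.card_singleton, Nat.card_Icc] at hcard
    simp only [columnSize] at hlt
    omega
  · intro hmem
    have hi := mem_triangle.1 (hD.subset hmem)
    have hsub : {i} ×ˢ Finset.Icc (n - h) n ⊆ D.filter (fun p => p.1 = i) := by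
      rintro ⟨i', j⟩ hp
      simp only [Finset.mem_product, Finset.mem_singleton, Finset.mem_Icc] at hp
      obtain ⟨rfl, hj⟩ := hp
      exact Finset.mem_filter.2 ⟨hD.mem_of_le hmem hj.1 hj.2, rfl⟩
    have hcard := Finset.card_le_card hsub
    simp only [Finset.card_product, Finset.card_singleton, Nat.card_Icc] at hcard
    simp only [columnSize]
    omega

/-- The rows of the diagram without gaps count the boxes on the descending diagonals. -/
theorem IsGappedSubdiagram.mem_removeGaps {n : ℕ} {D : Finset (ℕ × ℕ)}
    (hD : IsGappedSubdiagram n D) (h t : ℕ) :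
    (h, t) ∈ removeGaps n D ↔ t < (diagonal n D (n - h)).card := by
  rw [removeGaps, YoungDiagram.mem_transpose, Prod.swap_prod_mk, YoungDiagram.mem_ofRowLens]
  simp only
  rw [exists_lt_getElem_iff_lt_countP (Multiset.pairwise_sort _ _), ← Multiset.coe_countP,
    Multiset.sort_eq, Multiset.countP_map]
  simp only [hD.lt_columnSize_iff]
  rfl

theorem mem_staircase {n h t : ℕ} : (h, t) ∈ staircase n ↔ h + t < n := by
  rw [← YoungDiagram.mem_cells]
  simp only [staircase, Finset.mem_filter, Finset.mem_product, Finset.mem_range]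
  omega

theorem IsGappedSubdiagram.diagonal_subset {n : ℕ} {D : Finset (ℕ × ℕ)}
    (hD : IsGappedSubdiagram n D) (j : ℕ) : diagonal n D j ⊆ Finset.Icc 1 j := by
  intro i hi
  have := mem_triangle.1 (hD.subset (hD.mem_diagonal.1 hi))
  exact Finset.mem_Icc.2 (by omega)

theorem IsGappedSubdiagram.removeGaps_le_staircase {n : ℕ} {D : Finset (ℕ × ℕ)}
    (hD : IsGappedSubdiagram n D) : removeGaps n D ≤ staircase n := by
  rintro ⟨h, t⟩ hmem
  have hlt := (hD.mem_removeGaps h t).1 hmem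
  have hcard := Finset.card_le_card (hD.diagonal_subset (n - h))
  rw [Nat.card_Icc] at hcard
  exact mem_staircase.2 (by omega)

/-- `U` arises from `S` by adding the largest elements of `{1, …, m}` that are missing in `S`. -/
def IsTopExtension (m : ℕ) (S U : Finset ℕ) : Prop :=
  S ⊆ U ∧ U ⊆ Finset.Icc 1 m ∧ ∀ i ∈ U, i ∉ S → ∀ k, i ≤ k → k ≤ m → k ∈ U

/-- Elements `x ∈ U \ V` and `y ∈ V \ U` both lie outside `S`; the smaller one forces the larger
into its own set, a contradiction. -/
theorem IsTopExtension.subset_or_subset {m : ℕ} {S U V : Finset ℕ} (hU : IsTopExtension m S U)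
    (hV : IsTopExtension m S V) : U ⊆ V ∨ V ⊆ U := by
  by_contra hne
  rw [not_or, Finset.not_subset, Finset.not_subset] at hne
  obtain ⟨⟨x, hxU, hxV⟩, y, hyV, hyU⟩ := hne
  have hx := Finset.mem_Icc.1 (hU.2.1 hxU)
  have hy := Finset.mem_Icc.1 (hV.2.1 hyV)
  rcases le_total x y with h | h
  · exact hyU (hU.2.2 x hxU (fun hS => hxV (hV.1 hS)) y h hy.2)
  · exact hxV (hV.2.2 y hyV (fun hS => hyU (hU.1 hS)) x h hx.2)

theorem IsTopExtension.eq_of_card_eq {m : ℕ} {S U V : Finset ℕ} (hU : IsTopExtension m S U)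
    (hV : IsTopExtension m S V) (h : U.card = V.card) : U = V := by
  rcases hU.subset_or_subset hV with h' | h'
  · exact Finset.eq_of_subset_of_card_le h' h.ge
  · exact (Finset.eq_of_subset_of_card_le h' h.le).symm

theorem exists_isTopExtension {m N : ℕ} {S : Finset ℕ} (hS : S ⊆ Finset.Icc 1 m)
    (hN : S.card ≤ N) (hm : N ≤ m) : ∃ U, IsTopExtension m S U ∧ U.card = N := by
  induction N, hN using Nat.le_induction with
  | base => exact ⟨S, ⟨subset_rfl, hS, fun i hi hi' => absurd hi hi'⟩, rfl⟩
  | succ N _ ih =>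
    obtain ⟨U, ⟨h1, h2, h3⟩, hc⟩ := ih (by omega)
    have hne : (Finset.Icc 1 m \ U).Nonempty := by
      rw [← Finset.card_pos, Finset.card_sdiff_of_subset h2, Nat.card_Icc]
      omega
    obtain ⟨hx, hxU⟩ := Finset.mem_sdiff.1 (Finset.max'_mem _ hne)
    have hmax : ∀ k ∈ Finset.Icc 1 m \ U, k ≤ (Finset.Icc 1 m \ U).max' hne :=
      fun k hk => Finset.le_max' _ k hk
    generalize (Finset.Icc 1 m \ U).max' hne = x at hx hxU hmax
    -- `x` is the largest element missing in `U`, so everything above it is already present.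
    refine ⟨insert x U, ⟨h1.trans (Finset.subset_insert _ _), Finset.insert_subset hx h2, ?_⟩, ?_⟩
    · intro i hi hiS k hik hk
      rcases Finset.mem_insert.1 hi with rfl | hi
      · by_contra hkU
        rw [Finset.mem_insert, not_or] at hkU
        have := Finset.mem_Icc.1 hx
        have := hmax k (Finset.mem_sdiff.2 ⟨Finset.mem_Icc.2 (by omega), hkU.2⟩)
        omega
      · exact Finset.mem_insert_of_mem (h3 i hi hiS k hik hk)
    · rw [Finset.card_insert_of_notMem hxU, hc]

/-- A column that is new on diagonal `j + 1` has its lowest box there, so the floor condition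
applies to it. -/
theorem IsGappedSubdiagram.isTopExtension_diagonal {n : ℕ} {D : Finset (ℕ × ℕ)}
    (hD : IsGappedSubdiagram n D) {j : ℕ} (hj : j < n) :
    IsTopExtension (j + 1) (diagonal n D j) (diagonal n D (j + 1)) := by
  refine ⟨fun i hi => ?_, hD.diagonal_subset _, fun i hi hij k hik hk => ?_⟩
  · rw [hD.mem_diagonal] at hi ⊢
    exact hD.ceiling i j hi hj
  · rw [hD.mem_diagonal] at hi hij ⊢
    exact hD.floor i (j + 1) hi
      (fun j' hj' h => hij (hD.mem_of_le h (by omega) hj.le)) k hik hk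

/-! ### Injectivity and surjectivity of removing the gaps -/

theorem injOn_removeGaps (n : ℕ) : Set.InjOn (removeGaps n) {D | IsGappedSubdiagram n D} := by
  intro D hD D' hD' h
  have hD : IsGappedSubdiagram n D := hD
  have hD' : IsGappedSubdiagram n D' := hD'
  have hcard : ∀ j ≤ n, (diagonal n D j).card = (diagonal n D' j).card := by
    intro j hj
    refine eq_of_forall_lt_iff fun t => ?_
    have h1 := hD.mem_removeGaps (n - j) t
    have h2 := hD'.mem_removeGaps (n - j) t
    rw [Nat.sub_sub_self hj] at h1 h2
    rw [← h1, ← h2, h]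
  have hdiag : ∀ j ≤ n, diagonal n D j = diagonal n D' j := by
    intro j
    induction j with
    | zero =>
      intro _
      rw [Finset.subset_empty.1 (hD.diagonal_subset 0),
        Finset.subset_empty.1 (hD'.diagonal_subset 0)]
    | succ j ih =>
      intro hj
      have h1 := hD.isTopExtension_diagonal (j := j) hj
      rw [ih (by omega)] at h1
      exact h1.eq_of_card_eq (hD'.isTopExtension_diagonal (j := j) hj) (hcard _ hj)
  ext ⟨i, j⟩
  by_cases hj : j ≤ n
  · rw [← hD.mem_diagonal, ← hD'.mem_diagonal, hdiag j hj]
  · exact iff_of_false (fun h => hj (mem_triangle.1 (hD.subset h)).2.2)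
      (fun h => hj (mem_triangle.1 (hD'.subset h)).2.2)

theorem exists_chain_isTopExtension {N : ℕ → ℕ} (hmono : Monotone N) (hN : ∀ j, N j ≤ j) :
    ∃ S : ℕ → Finset ℕ, ∀ j,
      (S j ⊆ Finset.Icc 1 j ∧ (S j).card = N j) ∧ IsTopExtension (j + 1) (S j) (S (j + 1)) := by
  -- The assumptions on `S` stand inside the existential so that the choice function is total and
  -- can be iterated; `∅` is the default value.
  have hstep : ∀ j S, ∃ U, S ⊆ Finset.Icc 1 j ∧ S.card = N j →
      IsTopExtension (j + 1) S U ∧ U.card = N (j + 1) := by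
    intro j S
    by_cases hS : S ⊆ Finset.Icc 1 j ∧ S.card = N j
    · obtain ⟨U, hU⟩ := exists_isTopExtension (m := j + 1) (N := N (j + 1))
        (hS.1.trans (Finset.Icc_subset_Icc_right j.le_succ))
        (hS.2.le.trans (hmono j.le_succ)) (hN _)
      exact ⟨U, fun _ => hU⟩
    · exact ⟨∅, fun h => absurd h hS⟩
  choose f hf using hstep
  let S : ℕ → Finset ℕ := fun j => Nat.rec ∅ f j
  have hS : ∀ j, S j ⊆ Finset.Icc 1 j ∧ (S j).card = N j := by
    intro j
    induction j with
    | zero => exact ⟨Finset.empty_subset _, (Nat.le_zero.1 (hN 0)).symm⟩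
    | succ j ih => exact ⟨(hf j (S j) ih).1.2.1, (hf j (S j) ih).2⟩
  exact ⟨S, fun j => ⟨hS j, (hf j (S j) (hS j)).1⟩⟩

theorem exists_isGappedSubdiagram {S : ℕ → Finset ℕ} (n : ℕ)
    (hS : ∀ j, S j ⊆ Finset.Icc 1 j)
    (hext : ∀ j, IsTopExtension (j + 1) (S j) (S (j + 1))) :
    ∃ D, IsGappedSubdiagram n D ∧ ∀ j ≤ n, diagonal n D j = S j := by
  have hmem : ∀ i j, (i, j) ∈ (triangle n).filter (fun p => p.1 ∈ S p.2) ↔ j ≤ n ∧ i ∈ S j := by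
    intro i j
    rw [Finset.mem_filter, mem_triangle]
    constructor
    · exact fun h => ⟨h.1.2.2, h.2⟩
    · intro h
      have := Finset.mem_Icc.1 (hS j h.2)
      exact ⟨by omega, h.2⟩
  refine ⟨(triangle n).filter (fun p => p.1 ∈ S p.2), ⟨Finset.filter_subset _ _, ?_, ?_⟩, ?_⟩
  · intro i j h hj
    rw [hmem] at h ⊢
    exact ⟨hj, (hext j).1 h.2⟩
  · intro i j h hlow k hik hk
    rw [hmem] at h ⊢
    have hij := Finset.mem_Icc.1 (hS j h.2)
    -- `S 0` is empty, so `j` is positive; a lowest box on diagonal `l + 1` is one whose column is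
    -- not in `S l`.
    obtain ⟨j, rfl⟩ : ∃ l, j = l + 1 := ⟨j - 1, by omega⟩
    refine ⟨h.1, (hext j).2.2 i h.2 (fun hi => hlow j (by omega) ?_) k hik hk⟩
    exact (hmem i j).2 ⟨by omega, hi⟩
  · intro j hj
    ext i
    rw [diagonal, Finset.mem_filter, hmem]
    constructor
    · exact fun h => h.2.2
    · intro h
      have := Finset.mem_Icc.1 (hS j h)
      exact ⟨Finset.mem_Icc.2 (by omega), hj, h⟩

theorem surjOn_removeGaps (n : ℕ) :
    Set.SurjOn (removeGaps n) {D | IsGappedSubdiagram n D} {μ | μ ≤ staircase n} := by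
  intro μ hμ
  have hμ : μ ≤ staircase n := hμ
  have hrow : ∀ h t, t < μ.rowLen h → h + t < n := fun h t ht =>
    mem_staircase.1 (hμ (YoungDiagram.mem_cells _ |>.2 (YoungDiagram.mem_iff_lt_rowLen.2 ht)))
  -- By `hrow` the minimum equals the row length; writing it this way makes the bound by `j`
  -- immediate for every `j`.
  have hmono : Monotone fun j => min j (μ.rowLen (n - j)) := fun j k hjk =>
    min_le_min hjk (μ.rowLen_anti _ _ (by omega))
  obtain ⟨S, hS⟩ := exists_chain_isTopExtension hmono fun j => min_le_left _ _
  obtain ⟨D, hD, hdiag⟩ := exists_isGappedSubdiagram n (fun j => (hS j).1.1) fun j => (hS j).2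
  refine ⟨D, hD, ?_⟩
  ext ⟨h, t⟩
  rw [YoungDiagram.mem_cells, YoungDiagram.mem_cells, hD.mem_removeGaps, hdiag _ (Nat.sub_le _ _),
    (hS _).1.2, YoungDiagram.mem_iff_lt_rowLen, lt_min_iff]
  by_cases hh : h ≤ n
  · rw [Nat.sub_sub_self hh]
    refine ⟨fun h => h.2, fun ht => ⟨?_, ht⟩⟩
    have := hrow h t ht
    omega
  -- For `h > n` the truncated `n - h` is `0`, where the minimum vanishes; the staircase leaves row
  -- `h` of `μ` empty.
  · refine iff_of_false (fun ht => ?_) fun ht => ?_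
    · omega
    · have := hrow h t ht
      omega

end TorsionYoung

theorem mainTheorem3 (n : ℕ) :
    (∀ T : Finset (ℕ × ℕ), TorsionYoung.IsTorsionClass n T →
      TorsionYoung.recursiveDiagram T 1 n = TorsionYoung.columnFill n T) ∧
    Set.BijOn (fun T : Finset (ℕ × ℕ) => TorsionYoung.recursiveDiagram T 1 n)
      {T | TorsionYoung.IsTorsionClass n T} {D | TorsionYoung.IsGappedSubdiagram n D} ∧
    Set.BijOn (TorsionYoung.removeGaps n)
      {D | TorsionYoung.IsGappedSubdiagram n D} {μ | μ ≤ TorsionYoung.staircase n} :=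
  ⟨fun _ hT => hT.recursiveDiagram_eq, TorsionYoung.bijOn_recursiveDiagram n,
    fun _ hD => TorsionYoung.IsGappedSubdiagram.removeGaps_le_staircase hD,
    TorsionYoung.injOn_removeGaps n, TorsionYoung.surjOn_removeGaps n⟩
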